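/- Let $X$ be a finite connected graph in the sense of Serre: each edge $a$ has an origin $\mathrm o(a)$, an end $\mathrm e(a)$ and an opposite edge $-a\neq a$ with $\mathrm e(a)=\mathrm o(-a)$. Fix an orientation of $X$ (a choice of one positive edge in each pair $\{a,-a\}$). Let $(\mathcal G,X)$ be a graph of groups on $X$, with vertex groups $G_s$, edge groups $G_a=G_{-a}$ and monomorphisms $\phi_a:G_a\to G_{\mathrm o(a)}$, $\phi_{-a}:G_a\to G_{\mathrm e(a)}$, and let $T$ be a maximal tree of $X$; the triple $(\mathcal G,X,T)$ is called a decomposed graph of groups. Its fundamental group $\pi_1(\mathcal G,X)$ is the quotient of the free product of all the $G_s$ and of the free group on symbols $t_a$ ($a$ an edge) by the relations $\phi_a(h)=t_a\,\phi_{-a}(h)\,t_a^{-1}$ ($a$ a positive edge, $h\in G_a$), $t_{-a}=t_a^{-1}$ ($a$ an edge), and $t_a=1$ ($a$ an edge of $T$). The vertex subgroups of $\pi_1(\mathcal G,X)$ are the images of the groups $G_s$. A circuit at $u\in G_s$ consists of a closed path $(a_1,\dots,a_n)$ of $X$ ($n\ge 0$) with successive vertices $s=s_0,s_1,\dots,s_n=s$,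 of elements $c_i\in G_{a_i}$, and of elements $h_i\in G_{s_i}$ ($0\le i\le n$), such that, with $c_i^-=\phi_{a_i}(c_i)$ and $c_i^+=\phi_{-a_i}(c_i)$, one has $u=h_0c_1^-h_0^{-1}$, $c_i^+=h_ic_{i+1}^-h_i^{-1}$ for $1\le i<n$, and $c_n^+=h_nuh_n^{-1}$ (if $n=0$: $u=h_0uh_0^{-1}$). It is trivial if $n=0$, and reduced if there is no $i$ with $1\le i<n$, $a_{i+1}=-a_i$ and $h_i\in\phi_{-a_i}(G_{a_i})$. The graph of groups is without circuit if for every vertex $s$ and every $u\in G_s$ with $u\neq1$, every reduced circuit at $u$ is trivial. An element $x$ of a group is a root of $g$ if $x^n=g$ for some integer $n\neq0$. A group has trivial root structure (SRT) if for every $g\neq1$ in it the set of all roots of $g$ is contained in a cyclic subgroup. **Theorem.** Let $(\mathcal G,X,T)$ be a decomposed graph of groups without circuit, and let $g$ and $x$ be nontrivial elements of $\pi_1(\mathcal G,X)$. If $x$ is a root of $g$, then either $x$ and $g$ lie in one and the same conjugate of a vertex subgroup, or the centralizer $\mathcal Z(g)$ of $g$ in $\pi_1(\mathcal G,X)$ is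 infinite cyclic and $x\in\mathcal Z(g)$. Moreover, $\pi_1(\mathcal G,X)$ is SRT if and only if all the vertex groups $G_s$ are SRT. -/

import Mathlib

universe u₁ u₂ u₃ u₄

/-! Graphs in the sense of Serre.  An oriented graph is given by its positively oriented edges `E`,
each with its origin and its end.  The set of all (oriented) edges is `E × Bool`: the edge
`(e, true)` is `e`, the edge `(e, false)` is the opposite edge of `e`. -/

/-- A graph with vertex set `V`, and an orientation whose positive edges are the elements
of `E`. -/
structure OrientedGraph (V : Type u₁) (E : Type u₂) where
  src : E → V
  tgt : E → V

namespace OrientedGraph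

/-- The opposite edge `-a`. -/
def opp {E : Type u₂} (a : E × Bool) : E × Bool := (a.1, !a.2)

variable {V : Type u₁} {E : Type u₂}

/-- The origin `o(a)` of an edge. -/
def origin (X : OrientedGraph V E) : E × Bool → V
  | (e, true) => X.src e
  | (e, false) => X.tgt e

/-- The end `e(a) = o(-a)` of an edge. -/
def extremity (X : OrientedGraph V E) : E × Bool → V
  | (e, true) => X.tgt e
  | (e, false) => X.src e

/-- `X.IsPath s l t`: the list of edges `l` is a path from `s` to `t`
(the empty list is the trivial path at `s = t`). -/
def IsPath (X : OrientedGraph V E) : V → List (E × Bool) → V → Prop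
  | s, [], t => s = t
  | s, a :: l, t => X.origin a = s ∧ X.IsPath (X.extremity a) l t

/-- A path is reduced if no edge is directly followed by its opposite. -/
def IsReducedPath {E : Type u₂} (l : List (E × Bool)) : Prop :=
  l.IsChain (fun a b => b ≠ opp a)

/-- The subgraph having all the vertices of `X`, and the edges `± e`, `e ∈ T`, is a maximal tree
of `X`: any two vertices are joined by exactly one reduced path of this subgraph.
In particular `X` is then connected. -/
def IsMaximalTree (X : OrientedGraph V E) (T : Set E) : Prop :=
  ∀ s t : V, ∃! l : List (E × Bool),
    X.IsPath s l t ∧ (∀ a ∈ l, a.1 ∈ T) ∧ IsReducedPath l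

end OrientedGraph

/-- A graph of groups on the oriented graph `X`, with vertex groups `Gv s` and edge groups
`Ge e`. -/
structure GraphOfGroups {V : Type u₁} {E : Type u₂} (X : OrientedGraph V E)
    (Gv : V → Type u₃) (Ge : E → Type u₄) [∀ s, Group (Gv s)] [∀ e, Group (Ge e)] where
  toSrc : ∀ e : E, Ge e →* Gv (X.src e)
  toTgt : ∀ e : E, Ge e →* Gv (X.tgt e)
  toSrc_injective : ∀ e, Function.Injective (toSrc e)
  toTgt_injective : ∀ e, Function.Injective (toTgt e)

namespace GraphOfGroups

variable {V : Type u₁} {E : Type u₂} {X : OrientedGraph V E}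
  {Gv : V → Type u₃} {Ge : E → Type u₄} [∀ s, Group (Gv s)] [∀ e, Group (Ge e)]

/-- The monomorphism `φ_a : G_a → G_{o(a)}`, for any edge `a` (where `G_a = G_{-a}`). -/
def toOrigin (𝒢 : GraphOfGroups X Gv Ge) : (a : E × Bool) → Ge a.1 →* Gv (X.origin a)
  | (e, true) => 𝒢.toSrc e
  | (e, false) => 𝒢.toTgt e

/-- The monomorphism `φ_{-a} : G_a → G_{e(a)}`, for any edge `a`. -/
def toExtremity (𝒢 : GraphOfGroups X Gv Ge) : (a : E × Bool) → Ge a.1 →* Gv (X.extremity a)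
  | (e, true) => 𝒢.toTgt e
  | (e, false) => 𝒢.toSrc e

/-! ### The fundamental group -/

/-- The free product of all the vertex groups and of the free group on the symbols `t_a`,
for `a` an edge. -/
abbrev FreeProd (_𝒢 : GraphOfGroups X Gv Ge) : Type (max u₁ u₂ u₃) :=
  Monoid.Coprod (Monoid.CoprodI Gv) (FreeGroup (E × Bool))

/-- The vertex group `G_s` as a factor of the free product. -/
def vertexIncl (𝒢 : GraphOfGroups X Gv Ge) (s : V) : Gv s →* 𝒢.FreeProd :=
  Monoid.Coprod.inl.comp Monoid.CoprodI.of

/-- The free generator `t_a`. -/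
def edgeGen (𝒢 : GraphOfGroups X Gv Ge) (a : E × Bool) : 𝒢.FreeProd :=
  Monoid.Coprod.inr (FreeGroup.of a)

/-- The relators expressing, with respect to a maximal tree `T`, the relations
`φ_a(h) = t_a φ_{-a}(h) t_a⁻¹` for each positive edge `a` and each `h ∈ G_a`,
`t_{-a} = t_a⁻¹` for each edge `a`, and `t_a = 1` for each edge `a` of `T`. -/
def relators (𝒢 : GraphOfGroups X Gv Ge) (T : Set E) : Set 𝒢.FreeProd :=
  {r | ∃ (e : E) (h : Ge e),
      r = 𝒢.vertexIncl (X.src e) (𝒢.toSrc e h) *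
        (𝒢.edgeGen (e, true) * 𝒢.vertexIncl (X.tgt e) (𝒢.toTgt e h) *
          (𝒢.edgeGen (e, true))⁻¹)⁻¹} ∪
  {r | ∃ a : E × Bool, r = 𝒢.edgeGen (OrientedGraph.opp a) * 𝒢.edgeGen a} ∪
  {r | ∃ a : E × Bool, a.1 ∈ T ∧ r = 𝒢.edgeGen a}

/-- The fundamental group of the decomposed graph of groups `(𝒢, X, T)`. -/
abbrev PiOne (𝒢 : GraphOfGroups X Gv Ge) (T : Set E) : Type (max u₁ u₂ u₃) :=
  𝒢.FreeProd ⧸ Subgroup.normalClosure (𝒢.relators T)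

/-- The natural homomorphism from the vertex group `G_s` to the fundamental group. -/
def vertexHom (𝒢 : GraphOfGroups X Gv Ge) (T : Set E) (s : V) : Gv s →* 𝒢.PiOne T :=
  (QuotientGroup.mk' (Subgroup.normalClosure (𝒢.relators T))).comp (𝒢.vertexIncl s)

/-- The vertex subgroup of the fundamental group attached to the vertex `s`. -/
def vertexSubgroup (𝒢 : GraphOfGroups X Gv Ge) (T : Set E) (s : V) : Subgroup (𝒢.PiOne T) :=
  (𝒢.vertexHom T s).range

/-! ### Trajectories and circuits -/

/-- The trajectories ("trajets") from `u ∈ G_s` to `v ∈ G_t`: a path `(a₁, …, aₙ)` from `s` to `t`,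
elements `cᵢ` of the edge groups `G_{aᵢ}`, with images `cᵢ⁻ = φ_{aᵢ}(cᵢ)` in `G_{o(aᵢ)}` and
`cᵢ⁺ = φ_{-aᵢ}(cᵢ)` in `G_{e(aᵢ)}`, and elements `h₀, …, hₙ` of the vertex groups of the successive
vertices, such that `u = h₀ c₁⁻ h₀⁻¹`, `cᵢ⁺ = hᵢ cᵢ₊₁⁻ hᵢ⁻¹` and `cₙ⁺ = hₙ v hₙ⁻¹`
(and `u = h₀ v h₀⁻¹` if `n = 0`). -/
inductive Trajectory (𝒢 : GraphOfGroups X Gv Ge) :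
    (s t : V) → Gv s → Gv t → Type (max u₁ u₂ u₃ u₄)
  | nil {s : V} (u v h : Gv s) (hu : u = h * v * h⁻¹) : Trajectory 𝒢 s s u v
  | cons {t : V} {v : Gv t} (a : E × Bool) (u h : Gv (X.origin a)) (c : Ge a.1)
      (hu : u = h * 𝒢.toOrigin a c * h⁻¹)
      (rest : Trajectory 𝒢 (X.extremity a) t (𝒢.toExtremity a c) v) :
      Trajectory 𝒢 (X.origin a) t u v

namespace Trajectory

variable {𝒢 : GraphOfGroups X Gv Ge}

/-- A trajectory is trivial if its path is (`n = 0`). -/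
def IsTrivial {s t : V} {u : Gv s} {v : Gv t} : Trajectory 𝒢 s t u v → Prop
  | nil _ _ _ _ => True
  | cons _ _ _ _ _ _ => False

/-- The trajectory does not begin with an element `h` of the vertex group followed by the edge
`-a`, with `h ∈ G_{-a}⁻ = G_a⁺`. -/
def NoPinchAfter (a : E × Bool) {s t : V} {u : Gv s} {v : Gv t} : Trajectory 𝒢 s t u v → Prop
  | nil _ _ _ _ => True
  | cons b _ h _ _ _ => ¬ (b = OrientedGraph.opp a ∧ h ∈ (𝒢.toOrigin b).range)

/-- A trajectory is reduced if there is no `i` with `aᵢ₊₁ = -aᵢ` and `hᵢ ∈ G_{aᵢ}⁺`. -/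
def IsReduced {s t : V} {u : Gv s} {v : Gv t} : Trajectory 𝒢 s t u v → Prop
  | nil _ _ _ _ => True
  | cons a _ _ _ _ rest => rest.NoPinchAfter a ∧ rest.IsReduced

end Trajectory

/-- A graph of groups is without circuit if for each nontrivial element `u` of a vertex group
`G_s`, every reduced circuit at `u` (trajectory from `u ∈ G_s` to `u ∈ G_s`) is trivial. -/
def WithoutCircuit (𝒢 : GraphOfGroups X Gv Ge) : Prop :=
  ∀ (s : V) (u : Gv s), u ≠ 1 → ∀ C : Trajectory 𝒢 s s u u, C.IsReduced → C.IsTrivial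

end GraphOfGroups

/-- `x` is a root of `g`. -/
def IsRootOf {G : Type*} [Group G] (x g : G) : Prop :=
  ∃ n : ℤ, n ≠ 0 ∧ x ^ n = g

/-- A group has trivial root structure if for each nontrivial `g`, the set of all the roots of `g`
is contained in a cyclic subgroup. -/
def HasTrivialRootStructure (G : Type*) [Group G] : Prop :=
  ∀ g : G, g ≠ 1 → ∃ C : Subgroup G, IsCyclic C ∧ {x : G | IsRootOf x g} ⊆ (C : Set G)

/-! A root of `g` commutes with `g`, so everything reduces to computing centralizers. The
fundamental group is studied inside a multiple HNN extension whose base is the product of all vertex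
groups and whose stable letters are the edges. It acts on normal words, and the number of stable
letters is a length function whose Gromov product is the length of the longest common prefix.
Prefixes satisfy the ultrametric inequality, so this is a Lyndon length, playing the role of an
action on a tree.

If `g ≠ 1` is elliptic (conjugate into a vertex group), a reduced word commuting with it has length
zero, since otherwise reading it letter by letter gives a nontrivial reduced circuit. The
centralizer therefore lies in the same conjugate (`exists_eq_of_commute_conj`).

If `g` is not elliptic, a conjugate of minimal length is cyclically reduced
(`exists_gromov_eq_zero`), so the lengths of its powers grow linearly. By the elliptic case, no
nontrivial elliptic element commutes with `g`. The centralizer is thus torsion-free, and its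
elements have short representatives modulo `g`, so `⟨g⟩` is central of finite index
(`finite_quotient_zpowers`). A transfer argument then makes the centralizer cyclic. -/

/-! ### Multiple HNN extensions: normal words -/

/-- The data of a multiple HNN extension of the base group `P`: stable letters `t_a`, where `a`
runs over a type with an involution, subgroups `A a`, and partial isomorphisms
`θ a : A a → A (opp a)`; the relations are `x t_a = t_a (θ a x)` and `t_{opp a} = t_a⁻¹`. -/
structure HNNSystem (B P : Type*) [Group P] where
  opp : B → B
  opp_opp : ∀ a, opp (opp a) = a
  A : B → Subgroup P
  θ : B → P → P
  θ_mem : ∀ a x, x ∈ A a → θ a x ∈ A (opp a)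
  θ_θ : ∀ a x, x ∈ A a → θ (opp a) (θ a x) = x
  θ_mul : ∀ a x y, x ∈ A a → y ∈ A a → θ a (x * y) = θ a x * θ a y

/-- Words `r₁ t_{a₁} r₂ t_{a₂} ⋯ rₙ t_{aₙ} p`. -/
inductive HNNWord (B P : Type*) where
  | nil (p : P) : HNNWord B P
  | cons (a : B) (r : P) (w : HNNWord B P) : HNNWord B P

namespace HNNWord

variable {B P : Type*}

/-- The number of stable letters. -/
def length : HNNWord B P → ℕ
  | nil _ => 0
  | cons _ _ w => w.length + 1

open Classical in
/-- The length of the longest common prefix. -/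
noncomputable def lcp : HNNWord B P → HNNWord B P → ℕ
  | cons a r w, cons b q v => if a = b ∧ r = q then lcp w v + 1 else 0
  | _, _ => 0

/-- The ultrametric inequality for prefixes, source of `0`-hyperbolicity. The final base element of
a word is ignored by `lcp`. -/
theorem min_lcp_le (u v w : HNNWord B P) : min (lcp u v) (lcp v w) ≤ lcp u w := by
  induction u generalizing v w with
  | nil p => simp [lcp]
  | cons a r u ih =>
    cases v with
    | nil p => simp [lcp]
    | cons b q v =>
      cases w with
      | nil p => simp [lcp]
      | cons c z w =>
        have := ih v w
        simp only [lcp]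
        split_ifs with h1 h2 h3 h3 <;> simp_all

/-- The word begins with the stable letter `a`, preceded by the trivial base element. -/
def StartsWith [One P] (a : B) : HNNWord B P → Prop
  | nil _ => False
  | cons b r _ => b = a ∧ r = 1

end HNNWord

namespace HNNSystem

open HNNWord

variable {B P : Type*} [Group P] (S : HNNSystem B P)

theorem θ_one (a : B) : S.θ a 1 = 1 := by
  have := S.θ_mul a 1 1 (one_mem _) (one_mem _)
  simpa using this

open Classical in
/-- Representatives of the left cosets of `A a`, with `1` representing `A a`. -/
noncomputable def rep (a : B) (x : P) : P :=
  if x ∈ S.A a then 1 else (QuotientGroup.mk x : P ⧸ S.A a).out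

theorem rep_inv_mul_mem (a : B) (x : P) : (S.rep a x)⁻¹ * x ∈ S.A a := by
  unfold rep
  split_ifs with h
  · simpa using h
  · rw [← QuotientGroup.eq, QuotientGroup.out_eq']

theorem rep_eq_one (a : B) {x : P} : S.rep a x = 1 ↔ x ∈ S.A a := by
  constructor
  · intro h
    simpa [h] using S.rep_inv_mul_mem a x
  · intro h
    simp [rep, h]

theorem rep_mul (a : B) (x : P) {y : P} (hy : y ∈ S.A a) : S.rep a (x * y) = S.rep a x := by
  have h : (QuotientGroup.mk (x * y) : P ⧸ S.A a) = QuotientGroup.mk x := by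
    rw [QuotientGroup.eq]; simpa using hy
  unfold rep
  rw [h, Subgroup.mul_mem_cancel_right _ hy]

theorem rep_mul_rep (a : B) (x y : P) : S.rep a (x * S.rep a y) = S.rep a (x * y) := by
  conv_rhs => rw [← mul_inv_cancel_left (S.rep a y) y, ← mul_assoc]
  exact (S.rep_mul a _ (S.rep_inv_mul_mem a y)).symm

theorem rep_rep (a : B) (x : P) : S.rep a (S.rep a x) = S.rep a x := by
  simpa using S.rep_mul_rep a 1 x

/-- The component in `A a` of an element of the base group. -/
noncomputable def comp (a : B) (x : P) : P := (S.rep a x)⁻¹ * x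

theorem comp_mem (a : B) (x : P) : S.comp a x ∈ S.A a := S.rep_inv_mul_mem a x

theorem comp_of_rep (a : B) {x : P} (h : S.rep a x = x) : S.comp a x = 1 := by
  simp [comp, h]

/-- The cocycle identity that makes `act` an action. -/
theorem comp_mul (a : B) (x y : P) :
    S.comp a (x * y) = S.comp a (x * S.rep a y) * S.comp a y := by
  simp only [comp, rep_mul_rep]
  group

/-- A word is normal if its base elements are coset representatives and if it is reduced. -/
def Normal : HNNWord B P → Prop
  | nil _ => True
  | cons a r w => S.rep a r = r ∧ ¬ w.StartsWith (S.opp a) ∧ Normal w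

/-- Left multiplication by an element of the base group. -/
noncomputable def act : P → HNNWord B P → HNNWord B P
  | x, nil p => nil (x * p)
  | x, cons a r w => cons a (S.rep a (x * r)) (act (S.θ a (S.comp a (x * r))) w)

open Classical in
/-- Left multiplication by a stable letter. -/
noncomputable def stable (a : B) : HNNWord B P → HNNWord B P
  | nil p => cons a 1 (nil p)
  | cons b r w => if b = S.opp a ∧ r = 1 then w else cons a 1 (cons b r w)

theorem length_act (x : P) (w : HNNWord B P) : (S.act x w).length = w.length := by
  induction w generalizing x with
  | nil p => rfl
  | cons a r w ih => simp [act, HNNWord.length, ih]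

theorem act_one {w : HNNWord B P} (hw : S.Normal w) : S.act 1 w = w := by
  induction w with
  | nil p => simp [act]
  | cons a r w ih =>
    obtain ⟨h1, -, h3⟩ := hw
    simp [act, h1, S.comp_of_rep a h1, S.θ_one, ih h3]

theorem act_mul (x y : P) (w : HNNWord B P) : S.act (x * y) w = S.act x (S.act y w) := by
  induction w generalizing x y with
  | nil p => simp [act, mul_assoc]
  | cons a r w ih =>
    simp only [act]
    rw [rep_mul_rep, mul_assoc, comp_mul, S.θ_mul _ _ _ (S.comp_mem _ _) (S.comp_mem _ _), ih]

theorem startsWith_act {a : B} {x : P} (hx : x ∈ S.A a) {w : HNNWord B P} (hw : S.Normal w) :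
    (S.act x w).StartsWith a ↔ w.StartsWith a := by
  cases w with
  | nil p => rfl
  | cons b r w =>
    simp only [act, StartsWith]
    refine and_congr_right fun h => ?_
    subst h
    rw [rep_eq_one, Subgroup.mul_mem_cancel_left _ hx, ← rep_eq_one, hw.1]

theorem normal_act (x : P) {w : HNNWord B P} (hw : S.Normal w) : S.Normal (S.act x w) := by
  induction w generalizing x with
  | nil p => trivial
  | cons a r w ih =>
    obtain ⟨h1, h2, h3⟩ := hw
    refine ⟨S.rep_rep _ _, ?_, ih _ h3⟩
    rwa [S.startsWith_act (S.θ_mem _ _ (S.comp_mem _ _)) h3]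

theorem stable_of_not {a : B} {w : HNNWord B P} (h : ¬ w.StartsWith (S.opp a)) :
    S.stable a w = cons a 1 w := by
  cases w with
  | nil p => rfl
  | cons b r w => exact if_neg h

theorem stable_cons_opp (a : B) (w : HNNWord B P) :
    S.stable a (cons (S.opp a) 1 w) = w := by simp [stable]

theorem exists_of_startsWith {a : B} {w : HNNWord B P} (h : w.StartsWith a) :
    ∃ w', w = cons a 1 w' := by
  cases w with
  | nil p => exact h.elim
  | cons b r w => exact ⟨w, by rw [h.1, h.2]⟩

theorem normal_stable (a : B) {w : HNNWord B P} (hw : S.Normal w) : S.Normal (S.stable a w) := by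
  by_cases h : w.StartsWith (S.opp a)
  · obtain ⟨w, rfl⟩ := exists_of_startsWith h
    rw [stable_cons_opp]
    exact hw.2.2
  · rw [S.stable_of_not h]
    exact ⟨(S.rep_eq_one a).2 (one_mem _), h, hw⟩

theorem stable_stable (a : B) {w : HNNWord B P} (hw : S.Normal w) :
    S.stable a (S.stable (S.opp a) w) = w := by
  by_cases h : w.StartsWith (S.opp (S.opp a))
  · obtain ⟨w, rfl⟩ := exists_of_startsWith h
    rw [stable_cons_opp, S.stable_of_not (by simpa [S.opp_opp] using hw.2.1), S.opp_opp]
  · rw [S.stable_of_not h, stable_cons_opp]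

/-- The defining HNN relation, verified on normal words. It splits according to whether the stable
letter cancels. -/
theorem act_stable {a : B} {x : P} (hx : x ∈ S.A a) {w : HNNWord B P} (hw : S.Normal w) :
    S.act x (S.stable a w) = S.stable a (S.act (S.θ a x) w) := by
  have hx' := S.θ_mem a x hx
  by_cases h : w.StartsWith (S.opp a)
  · obtain ⟨w, rfl⟩ := exists_of_startsWith h
    have h1 : S.rep (S.opp a) (S.θ a x) = 1 := (S.rep_eq_one _).2 hx'
    simp [stable_cons_opp, act, h1, comp, S.θ_θ a x hx]
  · rw [S.stable_of_not h, S.stable_of_not (by rwa [S.startsWith_act hx' hw])]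
    have h1 : S.rep a x = 1 := (S.rep_eq_one _).2 hx
    simp [act, h1, comp]

/-- The set of normal words. -/
abbrev NormalWord := {w : HNNWord B P // S.Normal w}

/-- The action of the base group on normal words. -/
noncomputable def baseHom : P →* Equiv.Perm S.NormalWord where
  toFun x :=
    { toFun := fun w => ⟨S.act x w.1, S.normal_act x w.2⟩
      invFun := fun w => ⟨S.act x⁻¹ w.1, S.normal_act _ w.2⟩
      left_inv := fun w => Subtype.ext (by simp [← act_mul, S.act_one w.2])
      right_inv := fun w => Subtype.ext (by simp [← act_mul, S.act_one w.2]) }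
  map_one' := Equiv.ext fun w => Subtype.ext (S.act_one w.2)
  map_mul' x y := Equiv.ext fun w => Subtype.ext (S.act_mul x y w.1)

/-- The action of a stable letter on normal words. -/
noncomputable def stablePerm (a : B) : Equiv.Perm S.NormalWord where
  toFun w := ⟨S.stable a w.1, S.normal_stable a w.2⟩
  invFun w := ⟨S.stable (S.opp a) w.1, S.normal_stable _ w.2⟩
  left_inv w := Subtype.ext (by
    have := S.stable_stable (S.opp a) w.2
    rwa [S.opp_opp] at this)
  right_inv w := Subtype.ext (S.stable_stable a w.2)

@[simp] theorem coe_baseHom (x : P) (w : S.NormalWord) : (S.baseHom x w).1 = S.act x w.1 := rfl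

@[simp] theorem coe_stablePerm (a : B) (w : S.NormalWord) :
    (S.stablePerm a w).1 = S.stable a w.1 := rfl

theorem stablePerm_inv (a : B) : (S.stablePerm a)⁻¹ = S.stablePerm (S.opp a) :=
  Equiv.ext fun _ => rfl

theorem baseHom_mul_stablePerm {a : B} {x : P} (hx : x ∈ S.A a) :
    S.baseHom x * S.stablePerm a = S.stablePerm a * S.baseHom (S.θ a x) :=
  Equiv.ext fun w => Subtype.ext (S.act_stable hx w.2)

/-- The permutation defined by a word. -/
noncomputable def val : HNNWord B P → Equiv.Perm S.NormalWord
  | nil p => S.baseHom p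
  | cons a r w => S.baseHom r * S.stablePerm a * val w

/-- The empty word. -/
def base : S.NormalWord := ⟨nil 1, trivial⟩

theorem val_act (x : P) (w : HNNWord B P) : S.val (S.act x w) = S.baseHom x * S.val w := by
  induction w generalizing x with
  | nil p => simp [act, val]
  | cons a r w ih =>
    simp only [act, val, ih]
    have h := S.baseHom_mul_stablePerm (S.comp_mem a (x * r))
    have h2 : S.rep a (x * r) * S.comp a (x * r) = x * r := by simp [comp]
    rw [mul_assoc, ← mul_assoc (S.stablePerm a), ← h, ← mul_assoc, ← mul_assoc, ← map_mul, h2,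
      map_mul]
    simp only [mul_assoc]

theorem val_stable (a : B) (w : HNNWord B P) :
    S.val (S.stable a w) = S.stablePerm a * S.val w := by
  by_cases h : w.StartsWith (S.opp a)
  · obtain ⟨w, rfl⟩ := exists_of_startsWith h
    simp [stable_cons_opp, val, ← stablePerm_inv]
  · simp [S.stable_of_not h, val]

/-- The group of permutations of the set of normal words which are left translations. -/
noncomputable def translations : Subgroup (Equiv.Perm S.NormalWord) where
  carrier := {σ | ∀ w, S.val (σ w).1 = σ * S.val w.1}
  one_mem' w := by simp
  mul_mem' {σ τ} hσ hτ w := by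
    rw [Equiv.Perm.mul_apply, hσ, hτ, mul_assoc]
  inv_mem' {σ} hσ w := by
    have := hσ (σ⁻¹ w)
    rw [show σ (σ⁻¹ w) = w from Equiv.apply_symm_apply σ w] at this
    rw [this, inv_mul_cancel_left]

theorem baseHom_mem (x : P) : S.baseHom x ∈ S.translations := fun w => S.val_act x w.1

theorem stablePerm_mem (a : B) : S.stablePerm a ∈ S.translations := fun w => S.val_stable a w.1

/-! ### Cancellation and common prefixes -/

/-- Applying the inverse of `X` to `Y` cancels exactly the common prefix, and each common letter
disappears from both words. -/
theorem length_val_inv (X Y : S.NormalWord) :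
    ((S.val X.1)⁻¹ Y).1.length + 2 * lcp X.1 Y.1 = X.1.length + Y.1.length := by
  obtain ⟨X, hX⟩ := X
  induction X generalizing Y with
  | nil p =>
    simp only [val, ← map_inv, coe_baseHom, length_act, lcp, HNNWord.length]
    omega
  | cons a r X ih =>
    obtain ⟨h1, h2, h3⟩ := hX
    have key : ((S.val (cons a r X))⁻¹ Y) =
        (S.val X)⁻¹ (S.stablePerm (S.opp a) (S.baseHom r⁻¹ Y)) := by
      rw [val, mul_inv_rev, mul_inv_rev, stablePerm_inv, map_inv]; rfl
    have ih' := ih (S.stablePerm (S.opp a) (S.baseHom r⁻¹ Y)) h3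
    rw [← key] at ih'
    simp only [coe_stablePerm, coe_baseHom] at ih'
    obtain ⟨Y, hY⟩ := Y
    simp only at ih' ⊢
    -- Either `Y` has the same first syllable as `X`, which cancels, or a letter `opp a` is
    -- prepended. Normality of `cons a r X` prevents the tail `X` from cancelling that letter.
    by_cases h : (S.act r⁻¹ Y).StartsWith (S.opp (S.opp a))
    · obtain ⟨Y', hY'⟩ := exists_of_startsWith h
      rw [hY', stable_cons_opp] at ih'
      have hY2 : Y = S.act r (cons (S.opp (S.opp a)) 1 Y') := by
        rw [← hY', ← act_mul, mul_inv_cancel, S.act_one hY]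
      have hn : S.Normal Y' := by
        have := S.normal_act r⁻¹ hY
        rw [hY'] at this
        exact this.2.2
      rw [S.opp_opp] at hY2
      have : Y = cons a r Y' := by
        rw [hY2]
        simp [act, h1, S.comp_of_rep a h1, S.θ_one, S.act_one hn]
      subst this
      simp only [lcp, HNNWord.length, and_self, if_true]
      omega
    · rw [S.stable_of_not h] at ih'
      have e1 : lcp X (cons (S.opp a) 1 (S.act r⁻¹ Y)) = 0 := by
        cases X with
        | nil p => rfl
        | cons b q X => exact if_neg h2
      have e2 : lcp (cons a r X) Y = 0 := by
        cases Y with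
        | nil p => rfl
        | cons b q Y =>
          refine if_neg ?_
          rintro ⟨rfl, rfl⟩
          refine h ⟨(S.opp_opp a).symm, ?_⟩
          simp [rep_eq_one, one_mem]
      rw [e1] at ih'
      rw [e2]
      simp only [HNNWord.length, length_act] at ih' ⊢
      omega

/-- The length of a permutation of the set of normal words. -/
noncomputable def len (σ : Equiv.Perm S.NormalWord) : ℕ := (σ S.base).1.length

/-- A translation is recovered from its value on the empty word, so `length_val_inv` applies. -/
theorem len_inv_mul {σ τ : Equiv.Perm S.NormalWord} (hσ : σ ∈ S.translations) :
    S.len (σ⁻¹ * τ) + 2 * lcp (σ S.base).1 (τ S.base).1 = S.len σ + S.len τ := by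
  have h : S.val (σ S.base).1 = σ := by
    rw [hσ]; simp [base, val]
  have := S.length_val_inv (σ S.base) (τ S.base)
  rwa [h] at this

end HNNSystem

/-! ### Lyndon length functions -/

/-- `L` is a length function on the group `G`, with Gromov products `c`, for which `G` is
`0`-hyperbolic. -/
structure IsLyndonLength {G : Type*} [Group G] (L : G → ℕ) (c : G → G → ℕ) : Prop where
  one : L 1 = 0
  inv_mul : ∀ x y, L (x⁻¹ * y) + 2 * c x y = L x + L y
  min_le : ∀ x y z, min (c x y) (c y z) ≤ c x z

namespace IsLyndonLength

variable {G : Type*} [Group G] {L : G → ℕ} {c : G → G → ℕ} (h : IsLyndonLength L c)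
include h

theorem inv (x : G) : L x⁻¹ = L x := by
  have h1 := h.inv_mul x 1
  have h2 := h.inv_mul x⁻¹ 1
  have := h.one
  simp only [mul_one, inv_inv] at h1 h2
  omega

theorem comm (x y : G) : c x y = c y x := by
  have h1 := h.inv_mul x y
  have h2 := h.inv_mul y x
  have h3 := h.inv (x⁻¹ * y)
  simp only [mul_inv_rev, inv_inv] at h3
  omega

theorem pow {g : G} (h0 : 0 < L g) (hg : c g⁻¹ g = 0) (k : ℕ) : L (g ^ k) = k * L g := by
  -- Two consecutive exponents are carried along: comparing the lengths of `g ^ k` and `g ^ (k + 1)`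
  -- shows that `g ^ (k + 1)` shares a prefix with `g`, hence none with `g⁻¹`.
  have key : L (g ^ k) = k * L g ∧ L (g ^ (k + 1)) = (k + 1) * L g := by
    induction k with
    | zero => simp [h.one]
    | succ k ih =>
      refine ⟨ih.2, ?_⟩
      have h1 := h.inv_mul g (g ^ (k + 1))
      have h2 := h.inv_mul g⁻¹ (g ^ (k + 1))
      rw [pow_succ', inv_mul_cancel_left, ← pow_succ', ih.1, ih.2] at h1
      rw [inv_inv, ← pow_succ', h.inv, ih.2] at h2
      have h3 := h.min_le g⁻¹ (g ^ (k + 1)) g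
      rw [h.comm _ g, hg] at h3
      have h4 : 0 < c g (g ^ (k + 1)) := by
        by_contra hc
        have : c g (g ^ (k + 1)) = 0 := by omega
        rw [this] at h1
        ring_nf at h1
        omega
      have h5 : c g⁻¹ (g ^ (k + 1)) = 0 := by
        rcases min_le_iff.1 h3 with h | h <;> omega
      rw [h5] at h2
      rw [mul_zero, add_zero] at h2
      rw [h2]; ring
  exact key.1

theorem pow_ne_one {g : G} (h0 : 0 < L g) (hg : c g⁻¹ g = 0) {k : ℕ} (hk : k ≠ 0) :
    g ^ k ≠ 1 := by
  intro he
  have := h.pow h0 hg k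
  rw [he, h.one] at this
  rcases Nat.mul_eq_zero.1 this.symm with h | h <;> omega

/-- There is no cancellation in `z * g = g * z`, so both `z` and `g` are full prefixes of it and one
is a prefix of the other. If it were `g`, dividing by `g` would shorten `z`. -/
theorem lt_and_le_of_minimal {g z : G} (hg : 0 < L g) (hz : Commute z g)
    (hmin : L z ≤ L (g⁻¹ * z)) (hc : c z⁻¹ g = 0) : L z < L g ∧ L z ≤ c z g := by
  have h1 := h.inv_mul z⁻¹ g
  rw [inv_inv, hc, h.inv] at h1
  have h2 := h.inv_mul z (z * g)
  rw [inv_mul_cancel_left] at h2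
  have h3 := h.inv_mul g (z * g)
  rw [hz.eq, inv_mul_cancel_left, ← hz.eq] at h3
  have h4 := h.min_le z (z * g) g
  rw [h.comm _ g] at h4
  have h5 := h.inv_mul g z
  rw [h.comm g z] at h5
  rcases min_le_iff.1 h4 with h | h <;> omega

theorem exists_zpow_mul {g z : G} (h0 : 0 < L g) (hg : c g⁻¹ g = 0) (hz : Commute z g) :
    ∃ k : ℤ, L (g ^ k * z) < L g ∧
      (L (g ^ k * z) ≤ c (g ^ k * z) g ∨ L (g ^ k * z) ≤ c (g ^ k * z) g⁻¹) := by
  obtain ⟨k, hk⟩ : ∃ k : ℤ, ∀ j : ℤ, L (g ^ k * z) ≤ L (g ^ j * z) :=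
    ⟨_, fun j => Function.argmin_le (fun k : ℤ => L (g ^ k * z)) j⟩
  refine ⟨k, ?_⟩
  have hy : Commute (g ^ k * z) g := ((Commute.refl g).zpow_left k).mul_left hz
  have h1 : L (g ^ k * z) ≤ L (g⁻¹ * (g ^ k * z)) := by
    rw [← mul_assoc, ← zpow_neg_one, ← zpow_add]; exact hk _
  have h2 : L (g ^ k * z) ≤ L (g⁻¹⁻¹ * (g ^ k * z)) := by
    rw [← mul_assoc, inv_inv, ← zpow_one_add]; exact hk _
  generalize g ^ k * z = y at *
  -- `y⁻¹` cannot share a prefix with both `g` and `g⁻¹`, so the previous lemma applies to one of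
  -- them.
  have h3 := h.min_le g⁻¹ y⁻¹ g
  rw [hg] at h3
  rcases min_le_iff.1 h3 with h4 | h4
  · have := h.lt_and_le_of_minimal (by rwa [h.inv]) hy.inv_right h2
      (by rw [h.comm]; omega)
    rw [h.inv] at this
    exact ⟨this.1, Or.inr this.2⟩
  · have := h.lt_and_le_of_minimal h0 hy h1 (by omega)
    exact ⟨this.1, Or.inl this.2⟩

theorem length_inv_mul_eq_zero {x y a : G} (hx : L x ≤ c x a) (hy : L y ≤ c y a)
    (hxy : L x = L y) : L (x⁻¹ * y) = 0 := by
  have h1 := h.min_le x a y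
  rw [h.comm a y] at h1
  have h2 := h.inv_mul x y
  rcases min_le_iff.1 h1 with h | h <;> omega

/-- Each coset has a representative that is a prefix of `g` or of `g⁻¹`, shorter than `g`. Length
and direction determine it up to an element of length zero, which is trivial by `hfree`. -/
theorem finite_quotient_zpowers {g : G} (h0 : 0 < L g) (hg : c g⁻¹ g = 0)
    (hfree : ∀ z : G, Commute z g → L z = 0 → z = 1) :
    Finite (Subgroup.centralizer {g} ⧸
      Subgroup.zpowers (⟨g, Subgroup.mem_centralizer_singleton_iff.2 rfl⟩ :
        Subgroup.centralizer {g})) := by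
  classical
  set Z := Subgroup.centralizer {g}
  set γ : Z := ⟨g, Subgroup.mem_centralizer_singleton_iff.2 rfl⟩
  have hZ : ∀ z : Z, Commute z.1 g := fun z => Subgroup.mem_centralizer_singleton_iff.1 z.2
  let R := {z : Z // L z.1 < L g ∧ (L z.1 ≤ c z.1 g ∨ L z.1 ≤ c z.1 g⁻¹)}
  have hR : Finite R := by
    refine Finite.of_injective
      (fun z : R => ((⟨L z.1.1, z.2.1⟩ : Fin (L g)), decide (L z.1.1 ≤ c z.1.1 g))) ?_
    intro x y hxy
    simp only [Prod.mk.injEq, Fin.mk.injEq, decide_eq_decide] at hxy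
    have : L ((x.1.1)⁻¹ * y.1.1) = 0 := by
      by_cases hx : L x.1.1 ≤ c x.1.1 g
      · exact h.length_inv_mul_eq_zero hx (hxy.2.1 hx) hxy.1
      · exact h.length_inv_mul_eq_zero (x.2.2.resolve_left hx)
          (y.2.2.resolve_left fun hy => hx (hxy.2.2 hy)) hxy.1
    exact Subtype.ext (Subtype.ext (inv_mul_eq_one.1
      (hfree _ ((hZ x.1).inv_left.mul_left (hZ y.1)) this)))
  refine Finite.of_surjective (fun z : R => (QuotientGroup.mk z.1 : Z ⧸ Subgroup.zpowers γ)) ?_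
  intro q
  obtain ⟨z, rfl⟩ := QuotientGroup.mk_surjective q
  obtain ⟨k, hk⟩ := h.exists_zpow_mul h0 hg (hZ z)
  refine ⟨⟨γ ^ k * z, by simpa using hk⟩, ?_⟩
  rw [QuotientGroup.eq, Subgroup.mem_zpowers_iff]
  refine ⟨-k, Subtype.ext ?_⟩
  have := ((hZ z).inv_left.zpow_right (-k)).eq
  simp [γ, ← zpow_neg, this]

end IsLyndonLength

/-- A torsion-free group having a central cyclic subgroup of finite index is cyclic. -/
theorem isCyclic_of_finite_quotient_zpowers {Z : Type*} [Group Z] {γ : Z}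
    (hγ : ∀ z : Z, Commute γ z) (hfin : Finite (Z ⧸ Subgroup.zpowers γ))
    (htf : ∀ (z : Z) (n : ℕ), n ≠ 0 → z ^ n = 1 → z = 1) : IsCyclic Z := by
  have hle : Subgroup.zpowers γ ≤ Subgroup.center Z := by
    rw [Subgroup.zpowers_le, Subgroup.mem_center_iff]
    exact fun z => (hγ z).eq.symm
  have : (Subgroup.zpowers γ).FiniteIndex := Subgroup.finiteIndex_of_finite_quotient
  have : (Subgroup.center Z).FiniteIndex := Subgroup.finiteIndex_of_le hle
  have hcomm : ∀ x y : Z, x * y = y * x := by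
    -- The transfer to the centre is raising to the power of its index. Torsion-freeness makes it
    -- injective into an abelian group.
    have hinj : Function.Injective (MonoidHom.transferCenterPow Z) := by
      rw [injective_iff_map_eq_one]
      intro z hz
      refine htf z _ Subgroup.FiniteIndex.index_ne_zero (?_ : z ^ (Subgroup.center Z).index = 1)
      rw [← MonoidHom.transferCenterPow_apply, hz, Subgroup.coe_one]
    intro x y
    apply hinj
    rw [map_mul, map_mul]
    exact Subtype.ext (Subgroup.mem_center_iff.1 (Subtype.prop _) _)
  let _ : CommGroup Z := { mul_comm := hcomm }
  -- Once `Z` is abelian, the same power trick embeds it in `⟨γ⟩`.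
  let f : Z →* Subgroup.zpowers γ :=
    (powMonoidHom (Subgroup.zpowers γ).index).codRestrict _
      fun z => Subgroup.pow_index_mem _ z
  refine isCyclic_of_injective f ((injective_iff_map_eq_one f).2 fun z hz => ?_)
  exact htf z _ Subgroup.FiniteIndex.index_ne_zero (congrArg Subtype.val hz)

/-! ### Reduced paths in a maximal tree -/

namespace OrientedGraph

variable {V E : Type*}

theorem opp_opp (a : E × Bool) : opp (opp a) = a := by simp [opp]

theorem opp_ne (a : E × Bool) : opp a ≠ a := by
  rcases a with ⟨e, _ | _⟩ <;> simp [opp]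

theorem extremity_opp (X : OrientedGraph V E) (a : E × Bool) :
    X.extremity (opp a) = X.origin a := by
  rcases a with ⟨e, _ | _⟩ <;> rfl

namespace IsMaximalTree

variable {X : OrientedGraph V E} {T : Set E} (hT : X.IsMaximalTree T)

/-- The reduced path joining two vertices in a maximal tree. -/
noncomputable def path (s t : V) : List (E × Bool) := (hT s t).choose

theorem path_spec (s t : V) :
    X.IsPath s (hT.path s t) t ∧ (∀ a ∈ hT.path s t, a.1 ∈ T) ∧ IsReducedPath (hT.path s t) :=
  (hT s t).choose_spec.1

theorem path_eq {s t : V} {l : List (E × Bool)} (h : X.IsPath s l t) (h' : ∀ a ∈ l, a.1 ∈ T)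
    (h'' : IsReducedPath l) : hT.path s t = l :=
  ((hT s t).choose_spec.2 l ⟨h, h', h''⟩).symm

theorem path_origin (r : V) {a : E × Bool} (ha : a.1 ∈ T) :
    hT.path (X.origin a) r = a :: hT.path (X.extremity a) r ∨
      hT.path (X.extremity a) r = opp a :: hT.path (X.origin a) r := by
  obtain ⟨h1, h2, h3⟩ := hT.path_spec (X.extremity a) r
  generalize hT.path (X.extremity a) r = l at *
  have h4 : ∀ b ∈ a :: l, b.1 ∈ T := by simpa [ha] using fun b c h => h2 (b, c) h
  cases l with
  | nil => exact Or.inl (hT.path_eq ⟨rfl, h1⟩ h4 (by simp [IsReducedPath]))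
  | cons b l =>
    by_cases hb : b = opp a
    · subst hb
      right
      rw [hT.path_eq (X.extremity_opp a ▸ h1.2) (fun b hb => h2 b (List.mem_cons_of_mem _ hb))
        (List.IsChain.tail h3)]
    · exact Or.inl (hT.path_eq ⟨rfl, h1⟩ h4 (List.isChain_cons_cons.2 ⟨hb, h3⟩))

end IsMaximalTree

end OrientedGraph

namespace GraphOfGroups

open OrientedGraph

variable {V E : Type*} {X : OrientedGraph V E}
  {Gv : V → Type*} {Ge : E → Type*} [∀ s, Group (Gv s)] [∀ e, Group (Ge e)]

/-! ### Words -/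

/-- Words `h₀ t_{a₁} h₁ ⋯ t_{aₙ} hₙ`, where `(a₁, …, aₙ)` is a path of `X` and the `hᵢ` are in the
vertex groups of the successive vertices. -/
inductive PathWord (𝒢 : GraphOfGroups X Gv Ge) : V → V → Type _
  | nil {s : V} (h : Gv s) : PathWord 𝒢 s s
  | cons {t : V} (a : E × Bool) (h : Gv (X.origin a)) (w : PathWord 𝒢 (X.extremity a) t) :
      PathWord 𝒢 (X.origin a) t

namespace PathWord

variable {𝒢 : GraphOfGroups X Gv Ge}

/-- The length of the path of a word. -/
def length {s t : V} : 𝒢.PathWord s t → ℕ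
  | nil _ => 0
  | cons _ _ w => w.length + 1

/-- Left multiplication by an element of a vertex group. -/
def mulLeft : {s t : V} → 𝒢.PathWord s t → Gv s → 𝒢.PathWord s t
  | _, _, nil h, k => nil (k * h)
  | _, _, cons a h w, k => cons a (k * h) w

/-- Composition of words. -/
def append {s t u : V} : 𝒢.PathWord s t → 𝒢.PathWord t u → 𝒢.PathWord s u
  | nil h, v => v.mulLeft h
  | cons a h w, v => cons a h (w.append v)

/-- The word does not begin with an element `h` of the vertex group followed by the edge `-a`,
with `h` in the image of the edge group. -/
def NoPinchAfter (a : E × Bool) {s t : V} : 𝒢.PathWord s t → Prop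
  | nil _ => True
  | cons b h _ => ¬ (b = opp a ∧ h ∈ (𝒢.toOrigin b).range)

/-- Reduced words. -/
def IsReduced {s t : V} : 𝒢.PathWord s t → Prop
  | nil _ => True
  | cons a _ w => w.NoPinchAfter a ∧ w.IsReduced

theorem length_mulLeft {s t : V} (k : Gv s) (w : 𝒢.PathWord s t) :
    (w.mulLeft k).length = w.length := by
  cases w <;> rfl

theorem length_append {s t u : V} (w : 𝒢.PathWord s t) (v : 𝒢.PathWord t u) :
    (w.append v).length = w.length + v.length := by
  induction w with
  | nil h => simp [append, length, length_mulLeft]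
  | cons a h w ih => simp only [append, length, ih]; omega

theorem IsReduced.mulLeft {s t : V} (k : Gv s) {w : 𝒢.PathWord s t} (hw : w.IsReduced) :
    (w.mulLeft k).IsReduced := by
  cases w <;> exact hw

theorem NoPinchAfter.append {s t u : V} {a : E × Bool} {w : 𝒢.PathWord s t}
    {v : 𝒢.PathWord t u} (hw : w.NoPinchAfter a) (hv : ∀ k, (v.mulLeft k).NoPinchAfter a) :
    (w.append v).NoPinchAfter a := by
  cases w with
  | nil k => exact hv k
  | cons b h w => exact hw

theorem NoPinchAfter.append_congr {s t u u' : V} {w : 𝒢.PathWord s t} {v : 𝒢.PathWord t u}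
    {v' : 𝒢.PathWord t u'}
    (hv : ∀ k a, (v.mulLeft k).NoPinchAfter a → (v'.mulLeft k).NoPinchAfter a) {a : E × Bool}
    (hw : (w.append v).NoPinchAfter a) : (w.append v').NoPinchAfter a := by
  cases w with
  | nil k => exact hv _ _ hw
  | cons c k w => exact hw

/-- A pinch at the junction depends only on the first syllable of the second word, so that word may
be replaced by another with the same beginning. -/
theorem IsReduced.append_congr {s t u u' : V} {w : 𝒢.PathWord s t} {v : 𝒢.PathWord t u}
    {v' : 𝒢.PathWord t u'}
    (hv : ∀ k a, (v.mulLeft k).NoPinchAfter a → (v'.mulLeft k).NoPinchAfter a)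
    (hv' : v'.IsReduced) (hw : (w.append v).IsReduced) : (w.append v').IsReduced := by
  induction w with
  | nil k => exact hv'.mulLeft k
  | cons c k w ih => exact ⟨hw.1.append_congr hv, ih hv hv' hw.2⟩

/-- The value of a word in a group. -/
def eval {M : Type*} [Group M] (f : ∀ s, Gv s →* M) (τ : E × Bool → M) {s t : V} :
    𝒢.PathWord s t → M
  | @nil _ _ _ _ _ _ _ _ s h => f s h
  | cons a h w => f _ h * τ a * w.eval f τ

section eval

variable {M : Type*} [Group M] (f : ∀ s, Gv s →* M) (τ : E × Bool → M)

theorem eval_mulLeft {s t : V} (k : Gv s) (w : 𝒢.PathWord s t) :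
    (w.mulLeft k).eval f τ = f s k * w.eval f τ := by
  cases w <;> simp [mulLeft, eval, mul_assoc]

theorem eval_append {s t u : V} (w : 𝒢.PathWord s t) (v : 𝒢.PathWord t u) :
    (w.append v).eval f τ = w.eval f τ * v.eval f τ := by
  induction w with
  | nil h => simp [append, eval, eval_mulLeft]
  | cons a h w ih => simp [append, eval, ih, mul_assoc]

variable {f τ}

/-- Britton reduction: `t_a φ_{-a}(c) t_{-a}` collapses to `φ_a(c)`, which is absorbed by the next
base element. -/
theorem exists_of_not_noPinchAfter
    (hτ : ∀ a, τ (opp a) = (τ a)⁻¹)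
    (hf : ∀ a (c : Ge a.1), f _ (𝒢.toOrigin a c) * τ a = τ a * f _ (𝒢.toExtremity a c))
    {a : E × Bool} {t : V} {w : 𝒢.PathWord (X.extremity a) t} (hw : w.IsReduced)
    (h : ¬ w.NoPinchAfter a) :
    ∃ w' : 𝒢.PathWord (X.origin a) t, w'.IsReduced ∧ w'.length < w.length ∧
      w'.eval f τ = τ a * w.eval f τ := by
  generalize hs : X.extremity a = s at w
  cases w with
  | nil k => exact (h trivial).elim
  | cons b k w =>
    obtain ⟨rfl, c, rfl⟩ := not_not.1 h
    -- Fixing the orientation makes the endpoints of `opp a` definitionally those of `a` exchanged,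
    -- so no casts are needed.
    rcases a with ⟨e, _ | _⟩
    · have key : ∀ (c : Ge e) (w : 𝒢.PathWord (X.tgt e) t),
          (w.mulLeft (𝒢.toTgt e c)).eval f τ =
            τ (e, false) * (f (X.src e) (𝒢.toSrc e c) * τ (e, true) * w.eval f τ) := by
        intro c w
        have h1 := hf (e, true) c
        have h2 := hτ (e, true)
        simp only [opp, Bool.not_true] at h2
        change f (X.src e) (𝒢.toSrc e c) * τ (e, true) = τ (e, true) * f (X.tgt e) (𝒢.toTgt e c)
          at h1
        rw [eval_mulLeft, h1, h2]
        group
      exact ⟨mulLeft (s := X.tgt e) w (𝒢.toTgt e c), IsReduced.mulLeft (s := X.tgt e) _ hw.2,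
        (length_mulLeft (s := X.tgt e) _ w).trans_lt (Nat.lt_succ_self _), key c w⟩
    · have key : ∀ (c : Ge e) (w : 𝒢.PathWord (X.src e) t),
          (w.mulLeft (𝒢.toSrc e c)).eval f τ =
            τ (e, true) * (f (X.tgt e) (𝒢.toTgt e c) * τ (e, false) * w.eval f τ) := by
        intro c w
        have h1 := hf (e, false) c
        have h2 := hτ (e, false)
        simp only [opp, Bool.not_false] at h2
        change f (X.tgt e) (𝒢.toTgt e c) * τ (e, false) = τ (e, false) * f (X.src e) (𝒢.toSrc e c)
          at h1
        rw [eval_mulLeft, h1, h2]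
        group
      exact ⟨mulLeft (s := X.src e) w (𝒢.toSrc e c), IsReduced.mulLeft (s := X.src e) _ hw.2,
        (length_mulLeft (s := X.src e) _ w).trans_lt (Nat.lt_succ_self _), key c w⟩

theorem exists_isReduced
    (hτ : ∀ a, τ (opp a) = (τ a)⁻¹)
    (hf : ∀ a (c : Ge a.1), f _ (𝒢.toOrigin a c) * τ a = τ a * f _ (𝒢.toExtremity a c))
    {s t : V} (w : 𝒢.PathWord s t) :
    ∃ w' : 𝒢.PathWord s t, w'.IsReduced ∧ w'.length ≤ w.length ∧
      (w.IsReduced ∨ w'.length < w.length) ∧ w'.eval f τ = w.eval f τ := by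
  suffices ∃ w' : 𝒢.PathWord s t, w'.IsReduced ∧ (w' = w ∨ w'.length < w.length) ∧
      w'.eval f τ = w.eval f τ by
    obtain ⟨w', h1, rfl | h2, h3⟩ := this
    · exact ⟨w', h1, le_rfl, Or.inl h1, rfl⟩
    · exact ⟨w', h1, h2.le, Or.inr h2, h3⟩
  induction w with
  | nil h => exact ⟨nil h, trivial, Or.inl rfl, rfl⟩
  | cons a h w ih =>
    obtain ⟨w', h1, h2, h3⟩ := ih
    have h4 : w'.length ≤ w.length := h2.elim (fun h => h ▸ le_rfl) le_of_lt
    by_cases hp : w'.NoPinchAfter a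
    · refine ⟨cons a h w', ⟨hp, h1⟩, h2.imp (fun e => by rw [e]) fun h => ?_, by rw [eval, eval, h3]⟩
      simpa [length] using h
    · obtain ⟨w'', h5, h6, h7⟩ := exists_of_not_noPinchAfter hτ hf h1 hp
      refine ⟨w''.mulLeft h, h5.mulLeft h, Or.inr ?_, ?_⟩
      · rw [length_mulLeft, length]; omega
      · rw [eval_mulLeft, h7, eval, h3, mul_assoc]

end eval

end PathWord

end GraphOfGroups

namespace GraphOfGroups

open OrientedGraph

variable {V E : Type*} {X : OrientedGraph V E}
  {Gv : V → Type*} {Ge : E → Type*} [∀ s, Group (Gv s)] [∀ e, Group (Ge e)]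
  (𝒢 : GraphOfGroups X Gv Ge)

theorem toOrigin_injective (a : E × Bool) : Function.Injective (𝒢.toOrigin a) := by
  rcases a with ⟨e, _ | _⟩
  · exact 𝒢.toTgt_injective e
  · exact 𝒢.toSrc_injective e

/-! ### The associated multiple HNN extension -/

open Classical in
/-- The vertex group `G_s` as a factor of the product of all the vertex groups. -/
noncomputable def single (_𝒢 : GraphOfGroups X Gv Ge) (s : V) : Gv s →* ∀ s, Gv s :=
  MonoidHom.mulSingle Gv s

theorem single_injective (s : V) : Function.Injective (𝒢.single s) := by
  classical
  exact Pi.mulSingle_injective s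

/-- The edge group `G_a` as a subgroup of the product of all the vertex groups. -/
noncomputable def edgeSingle (a : E × Bool) : Ge a.1 →* ∀ s, Gv s :=
  (𝒢.single (X.origin a)).comp (𝒢.toOrigin a)

theorem edgeSingle_injective (a : E × Bool) : Function.Injective (𝒢.edgeSingle a) :=
  (𝒢.single_injective _).comp (𝒢.toOrigin_injective a)

theorem edgeSingle_opp (a : E × Bool) (c : Ge a.1) :
    𝒢.edgeSingle (opp a) c = 𝒢.single (X.extremity a) (𝒢.toExtremity a c) := by
  rcases a with ⟨e, _ | _⟩ <;> rfl

open Classical in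
/-- The partial isomorphism defined by an edge. -/
noncomputable def edgeIso (a : E × Bool) (x : ∀ s, Gv s) : ∀ s, Gv s :=
  if h : ∃ c, 𝒢.edgeSingle a c = x then 𝒢.edgeSingle (opp a) h.choose else 1

theorem edgeIso_edgeSingle (a : E × Bool) (c : Ge a.1) :
    𝒢.edgeIso a (𝒢.edgeSingle a c) = 𝒢.edgeSingle (opp a) c := by
  have h : ∃ c', 𝒢.edgeSingle a c' = 𝒢.edgeSingle a c := ⟨c, rfl⟩
  rw [edgeIso, dif_pos h, 𝒢.edgeSingle_injective a h.choose_spec]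

/-- The multiple HNN extension of the product of the vertex groups. -/
noncomputable def hnn : HNNSystem (E × Bool) (∀ s, Gv s) where
  opp := opp
  opp_opp := opp_opp
  A a := (𝒢.edgeSingle a).range
  θ := 𝒢.edgeIso
  θ_mem := by
    rintro a _ ⟨c, rfl⟩
    rw [edgeIso_edgeSingle]
    exact ⟨c, rfl⟩
  θ_θ := by
    rintro a _ ⟨c, rfl⟩
    rw [edgeIso_edgeSingle]
    refine (𝒢.edgeIso_edgeSingle (opp a) c).trans ?_
    rcases a with ⟨e, _ | _⟩ <;> rfl
  θ_mul := by
    rintro a _ _ ⟨c, rfl⟩ ⟨d, rfl⟩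
    rw [← map_mul, edgeIso_edgeSingle, edgeIso_edgeSingle, edgeIso_edgeSingle]
    exact map_mul (𝒢.edgeSingle (opp a)) c d

theorem single_mem_iff (a : E × Bool) (h : Gv (X.origin a)) :
    𝒢.single (X.origin a) h ∈ 𝒢.hnn.A a ↔ h ∈ (𝒢.toOrigin a).range :=
  exists_congr fun _ => (𝒢.single_injective _).eq_iff

/-- The group of permutations of normal words. -/
abbrev NPerm : Type _ := Equiv.Perm 𝒢.hnn.NormalWord

/-- The action of a vertex group on normal words. -/
noncomputable def vertexPerm (s : V) : Gv s →* 𝒢.NPerm := 𝒢.hnn.baseHom.comp (𝒢.single s)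

/-- The action of an edge on normal words. -/
noncomputable def edgePerm (a : E × Bool) : 𝒢.NPerm := 𝒢.hnn.stablePerm a

theorem edgePerm_opp (a : E × Bool) : 𝒢.edgePerm (opp a) = (𝒢.edgePerm a)⁻¹ :=
  (𝒢.hnn.stablePerm_inv a).symm

theorem vertexPerm_mul_edgePerm (a : E × Bool) (c : Ge a.1) :
    𝒢.vertexPerm _ (𝒢.toOrigin a c) * 𝒢.edgePerm a =
      𝒢.edgePerm a * 𝒢.vertexPerm _ (𝒢.toExtremity a c) := by
  refine (𝒢.hnn.baseHom_mul_stablePerm (a := a) (x := 𝒢.edgeSingle a c) ⟨c, rfl⟩).trans ?_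
  have : 𝒢.hnn.θ a (𝒢.edgeSingle a c) = 𝒢.single (X.extremity a) (𝒢.toExtremity a c) :=
    (𝒢.edgeIso_edgeSingle a c).trans (𝒢.edgeSingle_opp a c)
  rw [this]
  rfl

theorem vertexPerm_injective (s : V) : Function.Injective (𝒢.vertexPerm s) := by
  rw [injective_iff_map_eq_one]
  intro h hh
  have h1 : (𝒢.vertexPerm s h 𝒢.hnn.base).1 = HNNWord.nil 1 := by rw [hh]; rfl
  have h2 : HNNWord.nil (B := E × Bool) (𝒢.single s h * 1) = HNNWord.nil 1 := h1
  rw [HNNWord.nil.injEq, mul_one] at h2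
  exact (injective_iff_map_eq_one _).1 (𝒢.single_injective s) _ h2

namespace PathWord

variable {𝒢}

/-- The permutation of normal words defined by a word. -/
noncomputable def perm {s t : V} (w : 𝒢.PathWord s t) : 𝒢.NPerm :=
  w.eval 𝒢.vertexPerm 𝒢.edgePerm

theorem perm_mem_translations {s t : V} (w : 𝒢.PathWord s t) :
    w.perm ∈ 𝒢.hnn.translations := by
  induction w with
  | nil h => exact 𝒢.hnn.baseHom_mem _
  | cons a h w ih => exact mul_mem (mul_mem (𝒢.hnn.baseHom_mem _) (𝒢.hnn.stablePerm_mem _)) ih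

theorem perm_cons_apply {t : V} {a : E × Bool} (h : Gv (X.origin a))
    (w : 𝒢.PathWord (X.extremity a) t) (x : 𝒢.hnn.NormalWord) :
    ((cons a h w).perm x).1 =
      𝒢.hnn.act (𝒢.single _ h) (𝒢.hnn.stable a (w.perm x).1) := rfl

/-- The normal form theorem: a reduced word acts without cancellation. Any starting word of length
zero is allowed, because `mem_range_of_perm_eq` compares two of them. -/
theorem IsReduced.perm_apply {s t : V} {w : 𝒢.PathWord s t} (hw : w.IsReduced)
    {x : 𝒢.hnn.NormalWord} (hx : x.1.length = 0) :
    (w.perm x).1.length = w.length ∧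
      ∀ a, w.NoPinchAfter a → ¬ (w.perm x).1.StartsWith (opp a) := by
  induction w with
  | nil h =>
    obtain ⟨_ | _, hx'⟩ := x
    · exact ⟨rfl, fun _ _ h => h⟩
    · simp [HNNWord.length] at hx
  | cons a h w ih =>
    obtain ⟨h1, h2⟩ := ih hw.2
    have h3 : ¬ (w.perm x).1.StartsWith (𝒢.hnn.opp a) := h2 a hw.1
    rw [perm_cons_apply, 𝒢.hnn.length_act, 𝒢.hnn.stable_of_not h3]
    refine ⟨by simp [HNNWord.length, length, h1], fun b hb hs => ?_⟩
    refine hb ⟨hs.1, ?_⟩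
    have := (𝒢.hnn.rep_eq_one _).1 hs.2
    rwa [mul_one, single_mem_iff] at this

/-- Both sides, applied to the empty word, are normal words beginning with `a`. Equality of their
first coset representatives gives the claim. -/
theorem IsReduced.mem_range_of_perm_eq {t : V} {v : Gv t} {a : E × Bool}
    {u h : Gv (X.origin a)} {w : 𝒢.PathWord (X.extremity a) t} (hw : (cons a h w).IsReduced)
    (hu : 𝒢.vertexPerm _ u * (cons a h w).perm = (cons a h w).perm * 𝒢.vertexPerm t v) :
    h⁻¹ * u * h ∈ (𝒢.toOrigin a).range := by
  have h1 : (cons a h w).perm = 𝒢.vertexPerm _ h * (𝒢.edgePerm a * w.perm) := mul_assoc _ _ _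
  have h2 : 𝒢.vertexPerm _ (h⁻¹ * u * h) * (𝒢.edgePerm a * w.perm) =
      𝒢.edgePerm a * w.perm * 𝒢.vertexPerm t v := by
    rw [h1] at hu
    rw [map_mul, map_mul, map_inv, mul_assoc, mul_assoc, hu]
    group
  obtain ⟨-, h3⟩ := hw.2.perm_apply (x := 𝒢.hnn.base) rfl
  obtain ⟨-, h4⟩ := hw.2.perm_apply (x := 𝒢.vertexPerm t v 𝒢.hnn.base) rfl
  have h5 : 𝒢.hnn.act (𝒢.single _ (h⁻¹ * u * h)) (𝒢.hnn.stable a (w.perm 𝒢.hnn.base).1) =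
      𝒢.hnn.stable a (w.perm (𝒢.vertexPerm t v 𝒢.hnn.base)).1 :=
    congrArg (fun σ : 𝒢.NPerm => (σ 𝒢.hnn.base).1) h2
  rw [𝒢.hnn.stable_of_not (h3 a hw.1), 𝒢.hnn.stable_of_not (h4 a hw.1)] at h5
  have h6 := (HNNWord.cons.inj h5).2.1
  rwa [mul_one, HNNSystem.rep_eq_one, single_mem_iff] at h6

/-- Peeling off one letter pushes `u` through the edge group and leaves the same relation for the
tail. The elements met on the way form the trajectory. -/
theorem IsReduced.exists_trajectory {s t : V} {w : 𝒢.PathWord s t} (hw : w.IsReduced)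
    {u : Gv s} {v : Gv t} (hu : 𝒢.vertexPerm s u * w.perm = w.perm * 𝒢.vertexPerm t v) :
    ∃ C : Trajectory 𝒢 s t u v, C.IsReduced ∧ (C.IsTrivial → w.length = 0) ∧
      ∀ a, w.NoPinchAfter a → C.NoPinchAfter a := by
  induction w with
  | nil h =>
    refine ⟨.nil u v h (𝒢.vertexPerm_injective _ ?_), by simp [Trajectory.IsReduced],
      fun _ => rfl, fun _ _ => by simp [Trajectory.NoPinchAfter]⟩
    rw [map_mul, map_mul, map_inv, eq_mul_inv_iff_mul_eq]
    exact hu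
  | cons a h w ih =>
    obtain ⟨c, hc⟩ := hw.mem_range_of_perm_eq hu
    have huc : u = h * 𝒢.toOrigin a c * h⁻¹ := by rw [hc]; group
    have h1 : (cons a h w).perm = 𝒢.vertexPerm _ h * 𝒢.edgePerm a * w.perm := rfl
    obtain ⟨C, h2, -, h3⟩ := ih hw.2 (u := 𝒢.toExtremity a c) (v := v) (by
      have h4 := 𝒢.vertexPerm_mul_edgePerm a c
      rw [h1, mul_assoc (_ * _), mul_assoc (𝒢.vertexPerm _ h), huc, map_mul, map_mul,
        map_inv] at hu
      have h5 : 𝒢.edgePerm a * (w.perm * 𝒢.vertexPerm _ v) =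
          𝒢.vertexPerm _ (𝒢.toOrigin a c) * 𝒢.edgePerm a * w.perm := by
        rw [← mul_right_inj (𝒢.vertexPerm _ h), ← mul_assoc, ← hu]
        group
      rw [h4, mul_assoc, mul_right_inj] at h5
      exact h5.symm)
    exact ⟨.cons a u h c huc C, ⟨h3 a hw.1, h2⟩, fun h => h.elim, fun b hb => hb⟩

end PathWord

/-! ### The action of the fundamental group -/

variable (T : Set E)

/-- The image of `t_a` in the fundamental group. -/
def edgeElt (a : E × Bool) : 𝒢.PiOne T :=
  QuotientGroup.mk' (Subgroup.normalClosure (𝒢.relators T)) (𝒢.edgeGen a)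

theorem mk_eq_one {r : 𝒢.FreeProd} (hr : r ∈ 𝒢.relators T) :
    QuotientGroup.mk' (Subgroup.normalClosure (𝒢.relators T)) r = 1 :=
  (QuotientGroup.eq_one_iff r).2 (Subgroup.subset_normalClosure hr)

theorem edgeElt_opp (a : E × Bool) : 𝒢.edgeElt T (opp a) = (𝒢.edgeElt T a)⁻¹ := by
  rw [eq_inv_iff_mul_eq_one, edgeElt, edgeElt, ← map_mul]
  exact 𝒢.mk_eq_one T (Or.inl (Or.inr ⟨a, rfl⟩))

variable {T} in
theorem edgeElt_eq_one {a : E × Bool} (ha : a.1 ∈ T) : 𝒢.edgeElt T a = 1 :=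
  𝒢.mk_eq_one T (Or.inr ⟨a, ha, rfl⟩)

theorem vertexHom_mul_edgeElt (a : E × Bool) (c : Ge a.1) :
    𝒢.vertexHom T _ (𝒢.toOrigin a c) * 𝒢.edgeElt T a =
      𝒢.edgeElt T a * 𝒢.vertexHom T _ (𝒢.toExtremity a c) := by
  have key : ∀ (e : E) (c : Ge e), 𝒢.vertexHom T _ (𝒢.toSrc e c) * 𝒢.edgeElt T (e, true) =
      𝒢.edgeElt T (e, true) * 𝒢.vertexHom T _ (𝒢.toTgt e c) := by
    intro e c
    have := 𝒢.mk_eq_one T (Or.inl (Or.inl ⟨e, c, rfl⟩))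
    rw [map_mul, map_inv, mul_inv_eq_one, map_mul, map_mul, map_inv,
      eq_mul_inv_iff_mul_eq] at this
    exact this
  rcases a with ⟨e, _ | _⟩
  · have h1 := 𝒢.edgeElt_opp T (e, true)
    simp only [opp, Bool.not_true] at h1
    change 𝒢.vertexHom T _ (𝒢.toTgt e c) * 𝒢.edgeElt T (e, false) =
      𝒢.edgeElt T (e, false) * 𝒢.vertexHom T _ (𝒢.toSrc e c)
    rw [h1, eq_inv_mul_iff_mul_eq, ← mul_assoc, mul_inv_eq_iff_eq_mul]
    exact (key e c).symm
  · exact key e c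

variable {T} in
theorem mem_of_vertexHom_mem_of_edgeElt_mem {H : Subgroup (𝒢.PiOne T)}
    (hv : ∀ s h, 𝒢.vertexHom T s h ∈ H) (he : ∀ a, 𝒢.edgeElt T a ∈ H) (g : 𝒢.PiOne T) :
    g ∈ H := by
  obtain ⟨x, rfl⟩ := QuotientGroup.mk'_surjective _ g
  induction x using Monoid.Coprod.induction_on with
  | inl m =>
    induction m using Monoid.CoprodI.induction_on with
    | one => rw [map_one, map_one]; exact one_mem H
    | of s h => exact hv s h
    | mul x y hx hy => rw [map_mul, map_mul]; exact mul_mem hx hy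
  | inr n =>
    induction n using FreeGroup.induction_on with
    | C1 => rw [map_one, map_one]; exact one_mem H
    | of a => exact he a
    | inv_of a ha => rw [map_inv, map_inv]; exact inv_mem ha
    | mul x y hx hy => rw [map_mul, map_mul]; exact mul_mem hx hy
  | mul x y hx hy => rw [map_mul]; exact mul_mem hx hy

/-! ### Path words represent every element of the fundamental group -/

namespace PathWord

variable {𝒢}

/-- The element of the fundamental group defined by a word. -/
def val {s t : V} (w : 𝒢.PathWord s t) : 𝒢.PiOne T := w.eval (𝒢.vertexHom T) (𝒢.edgeElt T)

theorem val_append {s t u : V} (w : 𝒢.PathWord s t) (v : 𝒢.PathWord t u) :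
    (w.append v).val T = w.val T * v.val T := eval_append _ _ _ _

theorem exists_isReduced_val {s t : V} (w : 𝒢.PathWord s t) :
    ∃ w' : 𝒢.PathWord s t, w'.IsReduced ∧ w'.length ≤ w.length ∧
      (w.IsReduced ∨ w'.length < w.length) ∧ w'.val T = w.val T :=
  exists_isReduced (𝒢.edgeElt_opp T) (𝒢.vertexHom_mul_edgeElt T) w

theorem exists_val_eq_one_of_isPath {s t : V} {l : List (E × Bool)} (h : X.IsPath s l t)
    (hl : ∀ a ∈ l, a.1 ∈ T) : ∃ w : 𝒢.PathWord s t, w.val T = 1 := by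
  induction l generalizing s with
  | nil =>
    obtain rfl : s = t := h
    exact ⟨nil 1, map_one _⟩
  | cons a l ih =>
    obtain ⟨rfl, h⟩ := h
    obtain ⟨w, hw⟩ := ih h fun b hb => hl b (List.mem_cons_of_mem _ hb)
    refine ⟨cons a 1 w, ?_⟩
    change 𝒢.vertexHom T _ 1 * 𝒢.edgeElt T a * w.val T = 1
    rw [hw, 𝒢.edgeElt_eq_one (hl a List.mem_cons_self), map_one, one_mul, one_mul]

variable {T}

theorem exists_val_eq_one (hT : X.IsMaximalTree T) (s t : V) :
    ∃ w : 𝒢.PathWord s t, w.val T = 1 :=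
  exists_val_eq_one_of_isPath T (hT.path_spec s t).1 (hT.path_spec s t).2.1

/-- Words along tree paths have value `1`, so the endpoints can be chosen freely. -/
theorem exists_val_eq_inv (hT : X.IsMaximalTree T) {s t : V} (w : 𝒢.PathWord s t) (s' t' : V) :
    ∃ w' : 𝒢.PathWord s' t', w'.val T = (w.val T)⁻¹ := by
  induction w generalizing s' t' with
  | @nil s h =>
    obtain ⟨w₁, h₁⟩ := exists_val_eq_one (𝒢 := 𝒢) hT s' s
    obtain ⟨w₂, h₂⟩ := exists_val_eq_one (𝒢 := 𝒢) hT s t'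
    refine ⟨(w₁.append (nil h⁻¹)).append w₂, ?_⟩
    rw [val_append, val_append, h₁, h₂, one_mul, mul_one]
    exact map_inv _ _
  | cons a h w ih =>
    obtain ⟨w₁, h₁⟩ := ih s' (X.origin (opp a))
    obtain ⟨w₂, h₂⟩ := exists_val_eq_one (𝒢 := 𝒢) hT (X.extremity (opp a)) (X.origin a)
    obtain ⟨w₃, h₃⟩ := exists_val_eq_one (𝒢 := 𝒢) hT (X.origin a) t'
    -- The extremity of `opp a` equals the origin of `a` only propositionally; the word `w₂` of
    -- value `1` bridges them.
    refine ⟨w₁.append (cons (opp a) 1 (w₂.append ((nil h⁻¹).append w₃))), ?_⟩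
    rw [val_append]
    change _ * (𝒢.vertexHom T _ 1 * 𝒢.edgeElt T (opp a) * val T _) =
      (𝒢.vertexHom T _ h * 𝒢.edgeElt T a * w.val T)⁻¹
    rw [val_append, val_append, h₁, h₂, h₃, edgeElt_opp, map_one]
    change _ * (_ * _ * (1 * (𝒢.vertexHom T _ h⁻¹ * 1))) = _
    rw [map_inv]
    group

theorem exists_val_eq (hT : X.IsMaximalTree T) (g : 𝒢.PiOne T) (s t : V) :
    ∃ w : 𝒢.PathWord s t, w.val T = g := by
  let H : Subgroup (𝒢.PiOne T) :=
    { carrier := {g | ∀ s t : V, ∃ w : 𝒢.PathWord s t, w.val T = g}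
      one_mem' := exists_val_eq_one hT
      mul_mem' := fun {x y} hx hy s t => by
        obtain ⟨w, rfl⟩ := hx s t
        obtain ⟨w', rfl⟩ := hy t t
        exact ⟨w.append w', val_append T w w'⟩
      inv_mem' := fun {x} hx s t => by
        obtain ⟨w, rfl⟩ := hx s t
        exact exists_val_eq_inv hT w s t }
  have hv : ∀ s h, 𝒢.vertexHom T s h ∈ H := fun u h s t => by
    obtain ⟨w', h'⟩ := exists_val_eq_inv hT (nil h⁻¹ : 𝒢.PathWord u u) s t
    exact ⟨w', by rw [h', inv_eq_iff_eq_inv]; exact map_inv _ _⟩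
  have he : ∀ a, 𝒢.edgeElt T a ∈ H := fun a s t => by
    obtain ⟨w₁, h₁⟩ := exists_val_eq_one (𝒢 := 𝒢) hT s (X.origin a)
    obtain ⟨w₂, h₂⟩ := exists_val_eq_one (𝒢 := 𝒢) hT (X.extremity a) t
    refine ⟨w₁.append (cons a 1 w₂), ?_⟩
    rw [val_append, h₁, one_mul]
    change 𝒢.vertexHom T _ 1 * _ * val T w₂ = _
    rw [map_one, h₂, one_mul, mul_one]
  exact 𝒢.mem_of_vertexHom_mem_of_edgeElt_mem hv he g s t

end PathWord

end GraphOfGroups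

/-! ### Twisting the action by the maximal tree -/

namespace GraphOfGroups

open OrientedGraph

variable {V E : Type*} {X : OrientedGraph V E}
  {Gv : V → Type*} {Ge : E → Type*} [∀ s, Group (Gv s)] [∀ e, Group (Ge e)]
  (𝒢 : GraphOfGroups X Gv Ge) {T : Set E} (hT : X.IsMaximalTree T) (r : V)

/-- The permutation of normal words defined by the path of the maximal tree from `s` to `r`. -/
noncomputable def treePerm (s : V) : 𝒢.NPerm := ((hT.path s r).map 𝒢.edgePerm).prod

/-- Twisting by `treePerm` therefore sends `t_a` to `1` for tree edges, as the relators demand. -/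
theorem treePerm_origin {a : E × Bool} (ha : a.1 ∈ T) :
    𝒢.treePerm hT r (X.origin a) = 𝒢.edgePerm a * 𝒢.treePerm hT r (X.extremity a) := by
  rcases hT.path_origin r ha with h | h
  · rw [treePerm, treePerm, h, List.map_cons, List.prod_cons]
  · rw [treePerm, treePerm, h, List.map_cons, List.prod_cons, edgePerm_opp, mul_inv_cancel_left]

/-- The action on normal words, before passing to the fundamental group. -/
noncomputable def freeProdToPerm : 𝒢.FreeProd →* 𝒢.NPerm :=
  Monoid.Coprod.lift
    (Monoid.CoprodI.lift fun s =>
      (MulAut.conj (𝒢.treePerm hT r s)⁻¹).toMonoidHom.comp (𝒢.vertexPerm s))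
    (FreeGroup.lift fun a => (𝒢.treePerm hT r (X.origin a))⁻¹ * 𝒢.edgePerm a *
      𝒢.treePerm hT r (X.extremity a))

theorem freeProdToPerm_vertexIncl (s : V) (h : Gv s) :
    𝒢.freeProdToPerm hT r (𝒢.vertexIncl s h) =
      (𝒢.treePerm hT r s)⁻¹ * 𝒢.vertexPerm s h * 𝒢.treePerm hT r s := by
  simp [freeProdToPerm, vertexIncl]

theorem freeProdToPerm_edgeGen (a : E × Bool) :
    𝒢.freeProdToPerm hT r (𝒢.edgeGen a) =
      (𝒢.treePerm hT r (X.origin a))⁻¹ * 𝒢.edgePerm a * 𝒢.treePerm hT r (X.extremity a) := by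
  simp [freeProdToPerm, edgeGen]

/-- The action of the fundamental group on normal words. -/
noncomputable def toPerm : 𝒢.PiOne T →* 𝒢.NPerm :=
  QuotientGroup.lift _ (𝒢.freeProdToPerm hT r) <| by
    refine Subgroup.normalClosure_le_normal ?_
    rintro _ ((⟨e, h, rfl⟩ | ⟨a, rfl⟩) | ⟨a, ha, rfl⟩)
    · simp only [SetLike.mem_coe, MonoidHom.mem_ker]
      rw [map_mul, map_inv, mul_inv_eq_one, map_mul, map_mul, map_inv,
        freeProdToPerm_vertexIncl, freeProdToPerm_vertexIncl, freeProdToPerm_edgeGen,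
        eq_mul_inv_iff_mul_eq]
      have h1 : 𝒢.vertexPerm (X.src e) (𝒢.toSrc e h) * 𝒢.edgePerm (e, true) =
        𝒢.edgePerm (e, true) * 𝒢.vertexPerm (X.tgt e) (𝒢.toTgt e h) :=
        𝒢.vertexPerm_mul_edgePerm (e, true) h
      have h2 : X.origin (e, true) = X.src e := rfl
      have h3 : X.extremity (e, true) = X.tgt e := rfl
      rw [h2, h3]
      simp only [mul_assoc, mul_inv_cancel_left]
      rw [← mul_assoc (𝒢.vertexPerm _ _), h1]
      simp only [mul_assoc]
    · have h1 : X.origin (opp a) = X.extremity a := by rw [← extremity_opp, opp_opp]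
      simp only [SetLike.mem_coe, MonoidHom.mem_ker]
      rw [map_mul, freeProdToPerm_edgeGen, freeProdToPerm_edgeGen, edgePerm_opp, h1,
        extremity_opp]
      group
    · simp only [SetLike.mem_coe, MonoidHom.mem_ker]
      rw [freeProdToPerm_edgeGen, treePerm_origin 𝒢 hT r ha]
      group

theorem toPerm_vertexHom (s : V) (h : Gv s) :
    𝒢.toPerm hT r (𝒢.vertexHom T s h) =
      (𝒢.treePerm hT r s)⁻¹ * 𝒢.vertexPerm s h * 𝒢.treePerm hT r s :=
  𝒢.freeProdToPerm_vertexIncl hT r s h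

theorem toPerm_edgeElt (a : E × Bool) :
    𝒢.toPerm hT r (𝒢.edgeElt T a) =
      (𝒢.treePerm hT r (X.origin a))⁻¹ * 𝒢.edgePerm a * 𝒢.treePerm hT r (X.extremity a) :=
  𝒢.freeProdToPerm_edgeGen hT r a

/-- The tree factors telescope along the path, leaving only those at the endpoints. -/
theorem perm_eq {s t : V} (w : 𝒢.PathWord s t) :
    w.perm = 𝒢.treePerm hT r s * 𝒢.toPerm hT r (w.val T) * (𝒢.treePerm hT r t)⁻¹ := by
  induction w with
  | nil h =>
    change 𝒢.vertexPerm _ h = _ * 𝒢.toPerm hT r (𝒢.vertexHom T _ h) * _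
    rw [toPerm_vertexHom]
    group
  | cons a h w ih =>
    change 𝒢.vertexPerm _ h * 𝒢.edgePerm a * w.perm =
      _ * 𝒢.toPerm hT r (𝒢.vertexHom T _ h * 𝒢.edgeElt T a * w.val T) * _
    rw [map_mul, map_mul, toPerm_vertexHom, toPerm_edgeElt, ih]
    group

include hT in
theorem vertexHom_injective (s : V) : Function.Injective (𝒢.vertexHom T s) := by
  rw [injective_iff_map_eq_one]
  intro h hh
  have h1 := 𝒢.toPerm_vertexHom hT s s h
  rw [hh, map_one, eq_comm, mul_assoc, inv_mul_eq_one, eq_comm, mul_eq_right] at h1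
  exact (injective_iff_map_eq_one _).1 (𝒢.vertexPerm_injective s) _ h1

variable {𝒢} in
include hT in
/-- The centralizer of a nontrivial element of a vertex group is contained in this group. -/
theorem WithoutCircuit.exists_eq_vertexHom (h𝒢 : 𝒢.WithoutCircuit) {s : V} {u : Gv s}
    (hu : u ≠ 1) {g : 𝒢.PiOne T} (hg : Commute g (𝒢.vertexHom T s u)) :
    ∃ k, g = 𝒢.vertexHom T s k := by
  obtain ⟨w, rfl⟩ := PathWord.exists_val_eq hT g s s
  obtain ⟨w, hw, -, -, hval⟩ := w.exists_isReduced_val T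
  rw [← hval] at hg ⊢
  have h1 : 𝒢.vertexPerm s u * w.perm = w.perm * 𝒢.vertexPerm s u := by
    have h2 := congrArg (𝒢.toPerm hT s) hg.eq
    rw [map_mul, map_mul, toPerm_vertexHom] at h2
    rw [𝒢.perm_eq hT s w]
    have h3 := congrArg (fun x => 𝒢.treePerm hT s s * x * (𝒢.treePerm hT s s)⁻¹) h2
    simp only [mul_assoc, mul_inv_cancel_left, mul_inv_cancel, mul_one] at h3 ⊢
    exact h3.symm
  -- Commutation turns the reduced word into a reduced circuit at `u`, which must be trivial.
  obtain ⟨C, h2, h3, -⟩ := hw.exists_trajectory h1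
  have h4 := h3 (h𝒢 s u hu C h2)
  clear hval h1 h3 hg
  cases w with
  | nil k => exact ⟨k, rfl⟩
  | cons a k w => simp [PathWord.length] at h4

/-! ### Length functions on the fundamental group -/

/-- The action on normal words, with respect to the image under `k` of the vertex `s`. -/
noncomputable def conjPerm (s : V) (k : 𝒢.PiOne T) : 𝒢.PiOne T →* 𝒢.NPerm :=
  (MulAut.conj (𝒢.treePerm hT s s * 𝒢.toPerm hT s k⁻¹)).toMonoidHom.comp (𝒢.toPerm hT s)

theorem conjPerm_eq {s : V} {k g : 𝒢.PiOne T} {w : 𝒢.PathWord s s}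
    (hw : w.val T = k⁻¹ * g * k) : 𝒢.conjPerm hT s k g = w.perm := by
  rw [𝒢.perm_eq hT s w, hw]
  simp [conjPerm, mul_assoc]

theorem conjPerm_mem_translations (s : V) (k g : 𝒢.PiOne T) :
    𝒢.conjPerm hT s k g ∈ 𝒢.hnn.translations := by
  obtain ⟨w, hw⟩ := PathWord.exists_val_eq hT (k⁻¹ * g * k) s s
  rw [𝒢.conjPerm_eq hT hw]
  exact w.perm_mem_translations

/-- The length function with respect to the image under `k` of the vertex `s`. -/
noncomputable def len (s : V) (k g : 𝒢.PiOne T) : ℕ := 𝒢.hnn.len (𝒢.conjPerm hT s k g)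

/-- The Gromov product with respect to the image under `k` of the vertex `s`. -/
noncomputable def gromov (s : V) (k x y : 𝒢.PiOne T) : ℕ :=
  HNNWord.lcp (𝒢.conjPerm hT s k x 𝒢.hnn.base).1 (𝒢.conjPerm hT s k y 𝒢.hnn.base).1

theorem isLyndonLength_len (s : V) (k : 𝒢.PiOne T) :
    IsLyndonLength (𝒢.len hT s k) (𝒢.gromov hT s k) where
  one := by rw [len, map_one]; rfl
  inv_mul x y := by
    rw [len, map_mul, map_inv]
    exact 𝒢.hnn.len_inv_mul (𝒢.conjPerm_mem_translations hT s k x)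
  min_le _ _ _ := HNNWord.min_lcp_le _ _ _

theorem len_eq {s : V} {k g : 𝒢.PiOne T} {w : 𝒢.PathWord s s} (hw : w.IsReduced)
    (hval : w.val T = k⁻¹ * g * k) : 𝒢.len hT s k g = w.length := by
  rw [len, 𝒢.conjPerm_eq hT hval]
  exact (hw.perm_apply rfl).1

/-- The element `g` of the fundamental group is conjugate to an element of a vertex group. -/
def IsElliptic (g : 𝒢.PiOne T) : Prop :=
  ∃ (s : V) (k : 𝒢.PiOne T) (u : Gv s), g = k * 𝒢.vertexHom T s u * k⁻¹

variable {𝒢}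

theorem PathWord.isElliptic_of_length_eq_zero {s : V}
    {k g : 𝒢.PiOne T} {w : 𝒢.PathWord s s} (hval : w.val T = k⁻¹ * g * k)
    (hw : w.length = 0) : 𝒢.IsElliptic g := by
  have : ∃ u, w.val T = 𝒢.vertexHom T s u := by
    clear hval
    cases w with
    | nil u => exact ⟨u, rfl⟩
    | cons a k w => simp [PathWord.length] at hw
  obtain ⟨u, hu⟩ := this
  refine ⟨s, k, u, ?_⟩
  rw [← hu, hval]
  group

theorem isElliptic_of_len_eq_zero {s : V} {k g : 𝒢.PiOne T} (hg : 𝒢.len hT s k g = 0) :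
    𝒢.IsElliptic g := by
  obtain ⟨w, hw⟩ := PathWord.exists_val_eq hT (k⁻¹ * g * k) s s
  obtain ⟨w', h1, -, -, h2⟩ := w.exists_isReduced_val T
  rw [hw] at h2
  exact w'.isElliptic_of_length_eq_zero h2 (by rw [← 𝒢.len_eq hT h1 h2, hg])

-- A shortest closed word representing a conjugate of `g`, over all base vertices, is cyclically
-- reduced.
include r in
theorem exists_gromov_eq_zero {g : 𝒢.PiOne T} (hg : ¬ 𝒢.IsElliptic g) :
    ∃ (s : V) (k : 𝒢.PiOne T), 0 < 𝒢.len hT s k g ∧ 𝒢.gromov hT s k g⁻¹ g = 0 := by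
  classical
  let Q : ℕ → Prop := fun n => ∃ (s : V) (k : 𝒢.PiOne T) (w : 𝒢.PathWord s s),
    w.val T = k⁻¹ * g * k ∧ w.length = n
  have hQ : ∃ n, Q n := by
    obtain ⟨w, hw⟩ := PathWord.exists_val_eq hT (1⁻¹ * g * 1) r r
    exact ⟨_, r, 1, w, hw, rfl⟩
  have hred : ∀ {s : V} {k : 𝒢.PiOne T} {w : 𝒢.PathWord s s}, w.val T = k⁻¹ * g * k →
      w.length = Nat.find hQ → w.IsReduced := by
    intro s k w h1 h2
    obtain ⟨w', h3, -, h4, h5⟩ := w.exists_isReduced_val T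
    refine h4.resolve_right fun h6 => ?_
    exact Nat.find_min hQ (h2 ▸ h6) ⟨s, k, w', h5.trans h1, rfl⟩
  obtain ⟨s, k, w, hval, hlen⟩ := Nat.find_spec hQ
  have hw := hred hval hlen
  have hpos : 0 < w.length := by
    by_contra h
    exact hg (w.isElliptic_of_length_eq_zero hval (by omega))
  have hL := 𝒢.isLyndonLength_len hT s k
  have hLw := 𝒢.len_eq hT hw hval
  refine ⟨s, k, by rwa [hLw], ?_⟩
  have hww : (w.append w).IsReduced := by
    clear hL hLw
    cases w with
    | nil u => simp [PathWord.length] at hpos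
    | cons a u w =>
      have h1 : 𝒢.vertexHom T _ u * 𝒢.edgeElt T a * w.val T = k⁻¹ * g * k := hval
      -- Moving the first syllable to the end gives a conjugate of the same minimal length, hence
      -- again a reduced word. This excludes a pinch at the junction of `w` with itself.
      have h2 : (w.append (.cons a u (.nil 1))).IsReduced := by
        refine hred (k := k * (𝒢.vertexHom T _ u * 𝒢.edgeElt T a)) ?_ ?_
        · rw [PathWord.val_append]
          change _ * (𝒢.vertexHom T _ u * 𝒢.edgeElt T a * 𝒢.vertexHom T _ 1) = _
          rw [map_one, mul_one, mul_inv_rev, mul_assoc, mul_assoc, ← mul_assoc g,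
            ← mul_assoc k⁻¹, ← mul_assoc k⁻¹, ← h1]
          group
        · rw [PathWord.length_append, ← hlen]; rfl
      exact ⟨hw.1.append fun _ h => opp_ne a h.1.symm,
        PathWord.IsReduced.append_congr (v := .cons a u (.nil 1)) (fun _ _ h => h) hw h2⟩
  -- The square has twice the length, so the Gromov product of `g⁻¹` and `g` vanishes.
  have h1 := 𝒢.len_eq hT (g := g * g) (k := k) hww (by
    rw [PathWord.val_append, hval]; group)
  have h2 := hL.inv_mul g⁻¹ g
  rw [inv_inv, h1, hL.inv, PathWord.length_append, hLw] at h2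
  omega

/-! ### Centralizers in the absence of circuits -/

variable (h𝒢 : 𝒢.WithoutCircuit)
include hT h𝒢

theorem exists_eq_of_commute_conj {s : V} {k x : 𝒢.PiOne T} {u : Gv s}
    (hu : k * 𝒢.vertexHom T s u * k⁻¹ ≠ 1) (hx : Commute x (k * 𝒢.vertexHom T s u * k⁻¹)) :
    ∃ v, x = k * 𝒢.vertexHom T s v * k⁻¹ := by
  have hu' : u ≠ 1 := by
    rintro rfl
    simp at hu
  obtain ⟨v, hv⟩ := h𝒢.exists_eq_vertexHom hT hu' (g := k⁻¹ * x * k) (by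
    have h3 := congrArg (fun y => k⁻¹ * y * k) hx.eq
    change _ * _ = _ * _
    simpa [mul_assoc] using h3)
  refine ⟨v, ?_⟩
  rw [← hv]
  group

theorem isCyclic_centralizer {g : 𝒢.PiOne T} (hg1 : g ≠ 1) (hg : ¬ 𝒢.IsElliptic g) :
    IsCyclic (Subgroup.centralizer {g}) ∧ Infinite (Subgroup.centralizer {g}) := by
  -- Without vertices there are no edges either, and the fundamental group is trivial.
  have hr : Nonempty V := by
    by_contra hV
    rw [not_nonempty_iff] at hV
    exact hg1 (Subgroup.mem_bot.1 (𝒢.mem_of_vertexHom_mem_of_edgeElt_mem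
      (fun s => isEmptyElim s) (fun a => isEmptyElim (X.origin a)) g))
  obtain ⟨r⟩ := hr
  -- A nontrivial elliptic `z` commuting with `g` would force `g` into the same conjugate of a
  -- vertex group.
  have hZ : ∀ z, Commute z g → z ≠ 1 → ¬ 𝒢.IsElliptic z := by
    intro z hz hz1 he
    obtain ⟨s, k, u, rfl⟩ := he
    obtain ⟨v, h⟩ := exists_eq_of_commute_conj hT h𝒢 hz1 hz.symm
    exact hg ⟨s, k, v, h⟩
  have htf : ∀ z, Commute z g → ∀ n : ℕ, n ≠ 0 → z ^ n = 1 → z = 1 := by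
    intro z hz n hn h
    by_contra hz1
    obtain ⟨s, k, h1, h2⟩ := exists_gromov_eq_zero hT r (hZ z hz hz1)
    exact (𝒢.isLyndonLength_len hT s k).pow_ne_one h1 h2 hn h
  obtain ⟨s, k, h1, h2⟩ := exists_gromov_eq_zero hT r hg
  have hL := 𝒢.isLyndonLength_len hT s k
  have hfin := hL.finite_quotient_zpowers h1 h2 fun z hz h0 => by
    by_contra hz1
    exact hZ z hz hz1 (isElliptic_of_len_eq_zero hT h0)
  constructor
  · refine isCyclic_of_finite_quotient_zpowers ?_ hfin ?_
    · intro z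
      exact Subtype.ext (Subgroup.mem_centralizer_singleton_iff.1 z.2).symm
    · intro z n hn hz
      exact Subtype.ext (htf z (Subgroup.mem_centralizer_singleton_iff.1 z.2) n hn
        (congrArg Subtype.val hz))
  · let γ : Subgroup.centralizer {g} := ⟨g, Subgroup.mem_centralizer_singleton_iff.2 rfl⟩
    refine Infinite.of_injective (fun n : ℕ => γ ^ n) (injective_pow_iff_not_isOfFinOrder.2 ?_)
    rw [isOfFinOrder_iff_pow_eq_one]
    rintro ⟨n, hn, h⟩
    exact hL.pow_ne_one h1 h2 hn.ne' (congrArg Subtype.val h)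

end GraphOfGroups

/-! ### Roots and the main theorem -/

theorem IsRootOf.commute {G : Type*} [Group G] {x g : G} (h : IsRootOf x g) : Commute x g := by
  obtain ⟨n, -, rfl⟩ := h
  exact (Commute.refl x).zpow_right n

theorem HasTrivialRootStructure.of_injective {G H : Type*} [Group G] [Group H]
    (hH : HasTrivialRootStructure H) (f : G →* H) (hf : Function.Injective f) :
    HasTrivialRootStructure G := by
  intro g hg
  obtain ⟨C, hC, hle⟩ := hH (f g) ((map_ne_one_iff f hf).2 hg)
  refine ⟨C.comap f, isCyclic_of_injective (f.subgroupComap C) fun x y h => ?_, ?_⟩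
  · exact Subtype.ext (hf (congrArg Subtype.val h))
  · rintro x ⟨n, hn, rfl⟩
    exact hle ⟨n, hn, (map_zpow f x n).symm⟩

theorem mainTheorem11 {V : Type*} {E : Type*} [Finite V] [Finite E] (X : OrientedGraph V E)
    (Gv : V → Type*) (Ge : E → Type*) [∀ s, Group (Gv s)] [∀ e, Group (Ge e)]
    (𝒢 : GraphOfGroups X Gv Ge) (T : Set E) (hT : X.IsMaximalTree T)
    (h𝒢 : 𝒢.WithoutCircuit) :
    (∀ g x : 𝒢.PiOne T, g ≠ 1 → x ≠ 1 → IsRootOf x g →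
      (∃ (s : V) (k : 𝒢.PiOne T),
        x ∈ (𝒢.vertexSubgroup T s).map (MulAut.conj k).toMonoidHom ∧
        g ∈ (𝒢.vertexSubgroup T s).map (MulAut.conj k).toMonoidHom) ∨
      (IsCyclic (Subgroup.centralizer {g}) ∧ Infinite (Subgroup.centralizer {g}) ∧
        x ∈ Subgroup.centralizer {g})) ∧
    (HasTrivialRootStructure (𝒢.PiOne T) ↔ ∀ s : V, HasTrivialRootStructure (Gv s)) := by
  refine ⟨fun g x hg _ hx => ?_, fun h s => h.of_injective _ (𝒢.vertexHom_injective hT s),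
    fun h g hg => ?_⟩
  · by_cases he : 𝒢.IsElliptic g
    · obtain ⟨s, k, u, rfl⟩ := he
      obtain ⟨v, hv⟩ := GraphOfGroups.exists_eq_of_commute_conj hT h𝒢 hg hx.commute
      exact Or.inl ⟨s, k, ⟨_, ⟨v, rfl⟩, hv.symm⟩, ⟨_, ⟨u, rfl⟩, rfl⟩⟩
    · obtain ⟨h1, h2⟩ := GraphOfGroups.isCyclic_centralizer hT h𝒢 hg he
      exact Or.inr ⟨h1, h2, Subgroup.mem_centralizer_singleton_iff.2 hx.commute⟩
  · by_cases he : 𝒢.IsElliptic g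
    · obtain ⟨s, k, u, rfl⟩ := he
      have hu : u ≠ 1 := by
        rintro rfl
        simp at hg
      obtain ⟨C, hC, hle⟩ := h s u hu
      -- All roots of `g` lie in the image of `f`, so injectivity of `f` carries the cyclic subgroup
      -- found in `Gv s` over to the fundamental group.
      let f := (MulAut.conj k).toMonoidHom.comp (𝒢.vertexHom T s)
      have hf : Function.Injective f :=
        (MulAut.conj k).injective.comp (𝒢.vertexHom_injective hT s)
      refine ⟨C.map f, isCyclic_of_surjective (f.subgroupMap C) (f.subgroupMap_surjective C), ?_⟩
      intro x hx
      obtain ⟨v, rfl⟩ := GraphOfGroups.exists_eq_of_commute_conj hT h𝒢 hg (IsRootOf.commute hx)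
      obtain ⟨n, hn, hvu⟩ := hx
      exact ⟨v, hle ⟨n, hn, hf ((map_zpow f v n).trans hvu)⟩, rfl⟩
    · exact ⟨_, (GraphOfGroups.isCyclic_centralizer hT h𝒢 hg he).1, fun x hx =>
        Subgroup.mem_centralizer_singleton_iff.2 (IsRootOf.commute hx)⟩
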